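/- Let $\mathcal{H}$ and $\mathcal{G}$ be real Hilbert spaces. For a set-valued operator $A\colon\mathcal{G}\to 2^{\mathcal{G}}$, let $\operatorname{gra}A=\{(y,y^*)\in\mathcal{G}\times\mathcal{G} : y^*\in Ay\}$ be its graph and let $A^{-1}$ be the operator with $y\in A^{-1}y^*\Leftrightarrow y^*\in Ay$; the same notation is used on $\mathcal{H}$. The operator $A$ is monotone if $\langle y_1-y_2, y_1^*-y_2^*\rangle\geq 0$ for all $(y_1,y_1^*),(y_2,y_2^*)\in\operatorname{gra}A$, and maximally monotone if it is monotone and no monotone operator has a graph properly containing $\operatorname{gra}A$. For a bounded linear operator $L\colon\mathcal{H}\to\mathcal{G}$ with adjoint $L^*$, the parallel composition of $A\colon\mathcal{G}\to 2^{\mathcal{G}}$ by $L^*$ is the operator $L^*\triangleright A=(L^*\circ A^{-1}\circ L)^{-1}\colon\mathcal{H}\to 2^{\mathcal{H}}$. For $\gamma\in\left]0,+\infty\right[$ and $B\colon\mathcal{G}\to 2^{\mathcal{G}}$, the resolvent composition and the resolvent cocomposition of $B$ and $L$ with parameter $\gamma$ are the operators from $\mathcal{H}$ to $2^{\mathcal{H}}$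 $$L\diamond_{\gamma}B=L^*\triangleright(B+\gamma^{-1}\mathrm{Id}_{\mathcal{G}})-\gamma^{-1}\mathrm{Id}_{\mathcal{H}}\qquad\text{and}\qquad L\mathbin{\blacklozenge}_{\gamma}B=\bigl(L\diamond_{1/\gamma}B^{-1}\bigr)^{-1}.$$ For a sequence $(C_n)_{n\in\mathbb{N}}$ of sets, the lower limit $\varliminf C_n$ is the set of limits of convergent sequences $(x_n)_{n\in\mathbb{N}}$ with $x_n\in C_n$ for every $n\in\mathbb{N}$, and the upper limit $\varlimsup C_n$ is the set of limits of convergent sequences $(x_n)_{n\in\mathbb{N}}$ for which there is a strictly increasing sequence $(k_n)_{n\in\mathbb{N}}$ in $\mathbb{N}$ with $x_n\in C_{k_n}$ for every $n\in\mathbb{N}$. Operators $A_n$ graph-converge to $A$, written $A_n\xrightarrow{g}A$, if $\varliminf\operatorname{gra}A_n=\varlimsup\operatorname{gra}A_n=\operatorname{gra}A$. **Proposition.** Let $(L_n)_{n\in\mathbb{N}}$ and $L$ be bounded linear operators from $\mathcal{H}$ to $\mathcal{G}$, let $(B_n)_{n\in\mathbb{N}}$ and $B$ be maximally monotone operators from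 $\mathcal{G}$ to $2^{\mathcal{G}}$, and let $(\gamma_n)_{n\in\mathbb{N}}$ and $\gamma$ be in $\left]0,+\infty\right[$. Suppose that $L_n\to L$ in operator norm, $B_n\xrightarrow{g}B$, $\gamma_n\to\gamma$, and $\|L_n\|\leq 1$ for every $n\in\mathbb{N}$. Then: 1. $L_n\diamond_{\gamma_n}B_n\xrightarrow{g}L\diamond_{\gamma}B$. 2. $L_n\mathbin{\blacklozenge}_{\gamma_n}B_n\xrightarrow{g}L\mathbin{\blacklozenge}_{\gamma}B$. -/

import Mathlib

open Filter Topology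
open scoped Pointwise

namespace ResolventComp

/-- The graph of a set-valued operator. -/
def gra {X Y : Type*} (A : X → Set Y) : Set (X × Y) := {p | p.2 ∈ A p.1}

/-- The inverse of a set-valued operator. -/
def inv {X Y : Type*} (A : X → Set Y) : Y → Set X := fun y => {x | y ∈ A x}

/-- Monotonicity of a set-valued operator on a real Hilbert space. -/
def IsMonotone {H : Type*} [NormedAddCommGroup H] [InnerProductSpace ℝ H]
    (A : H → Set H) : Prop :=
  ∀ p ∈ gra A, ∀ q ∈ gra A, 0 ≤ inner ℝ (p.1 - q.1) (p.2 - q.2)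

/-- Maximal monotonicity: no monotone operator has a graph that properly contains that of `A`. -/
def IsMaximallyMonotone {H : Type*} [NormedAddCommGroup H] [InnerProductSpace ℝ H]
    (A : H → Set H) : Prop :=
  IsMonotone A ∧ ¬ ∃ B : H → Set H, IsMonotone B ∧ gra A ⊂ gra B

/-- The Painlevé–Kuratowski lower limit of a sequence of sets: limits of sequences of points
`x n ∈ C n`. -/
def lowerLimit {X : Type*} [TopologicalSpace X] (C : ℕ → Set X) : Set X :=
  {x | ∃ u : ℕ → X, (∀ n, u n ∈ C n) ∧ Tendsto u atTop (𝓝 x)}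

/-- The Painlevé–Kuratowski upper limit of a sequence of sets: limits of sequences of points
taken from a subsequence of the sets. -/
def upperLimit {X : Type*} [TopologicalSpace X] (C : ℕ → Set X) : Set X :=
  {x | ∃ (u : ℕ → X) (k : ℕ → ℕ), StrictMono k ∧ (∀ n, u n ∈ C (k n)) ∧ Tendsto u atTop (𝓝 x)}

/-- Painlevé–Kuratowski convergence of a sequence of sets to a set. -/
def PKConverges {X : Type*} [TopologicalSpace X] (C : ℕ → Set X) (D : Set X) : Prop :=
  lowerLimit C = D ∧ upperLimit C = D

/-- Graph-convergence of set-valued operators. -/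
def GraphConverges {H : Type*} [TopologicalSpace H] (A : ℕ → H → Set H) (A' : H → Set H) : Prop :=
  PKConverges (fun n => gra (A n)) (gra A')

section Compositions

variable {H G : Type*} [NormedAddCommGroup H] [InnerProductSpace ℝ H] [CompleteSpace H]
  [NormedAddCommGroup G] [InnerProductSpace ℝ G] [CompleteSpace G]

/-- The parallel composition of `A` by `M`, that is, `(M ∘ A⁻¹ ∘ M*)⁻¹`. -/
noncomputable def parallelComp (M : G →L[ℝ] H) (A : G → Set G) : H → Set H :=
  inv (fun x => M '' inv A (ContinuousLinearMap.adjoint M x))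

/-- The resolvent composition of `B` and `L` with parameter `γ`: the parallel composition of
`B + γ⁻¹ Id` by `L*`, minus `γ⁻¹ Id`. -/
noncomputable def resolventComp (L : H →L[ℝ] G) (γ : ℝ) (B : G → Set G) : H → Set H :=
  fun x =>
    parallelComp (ContinuousLinearMap.adjoint L) (fun y => B y + {γ⁻¹ • y}) x - {γ⁻¹ • x}

/-- The resolvent cocomposition of `B` and `L` with parameter `γ`: the inverse of the resolvent
composition of `B⁻¹` and `L` with parameter `1 / γ`. -/
noncomputable def resolventCocomp (L : H →L[ℝ] G) (γ : ℝ) (B : G → Set G) : H → Set H :=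
  inv (resolventComp L (1 / γ) (inv B))

end Compositions

end ResolventComp

/-!
The resolvent of the resolvent composition `L ◇_γ B` is `L* ∘ J ∘ L`, where `J = (Id + γ B)⁻¹`: a pair
`(x, u)` lies in the graph of `L ◇_γ B` exactly when some `(y, v)` in the graph of `B` satisfies
`y + γ v = L (x + γ u)` and `x = L* y` (`mem_gra_resolventComp_iff`). Graph convergence thus reduces
to the convergence of resolvents.

* By Minty's theorem (`IsMaximallyMonotone.exists_add_smul_eq`) the resolvent of a maximally
  monotone operator is defined everywhere.
* Resolvents are nonexpansive, so if the graphs of `B n` contain points converging to a point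
  `(y, v)` of the graph of `B`, then the resolvents of `B n` at points converging to `y + γ v`
  converge to `y` (`tendsto_fst_of_tendsto_add_smul`).

To approximate a point `(x, u)` of the graph of `L ◇_γ B`, evaluate the resolvents for `L n`, `B n`,
`γ n` at the fixed point `x + γ u`; conversely, if points `(x n, u n)` of the graphs converge to
`(x, u)`, then `x n + γ n • u n` converges to `x + γ u`, and the limit of the resolvents there
identifies `x`. The statement on cocompositions is the one on compositions applied to the
inverses `(B n)⁻¹` with the parameters `1 / γ n`.

Minty's theorem is proved by minimising `F + ‖·‖² / 2` over `H × H`, where `F` is the Fitzpatrick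
function of the graph `S`,
`F (x, u) = sup {⟪x, b⟫ + ⟪a, u⟫ - ⟪a, b⟫ | (a, b) ∈ S}`.
It is convex and lower semicontinuous, it dominates `⟪x, u⟫` everywhere by maximality, and it equals
`⟪a, b⟫` on `S`. The sum is strongly convex, hence attains its minimum, without any use of weak
compactness, and the optimality condition at the minimiser `(x, u)` says that `(-u, -x)` is
monotonically related to `S`; so it belongs to `S`, and this forces `u = -x`.
-/

namespace ResolventComp

/-! ### Minimising a convex function plus half the squared norm -/

section Minimisation

variable {V : Type*} [NormedAddCommGroup V] [InnerProductSpace ℝ V]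

/-- The parallelogram identity, in the form that makes minimising sequences Cauchy. -/
lemma midpoint_add_half_sq_norm (z w : V) (s t : ℝ) :
    ((1 / 2 : ℝ) * s + (1 / 2) * t) + ‖(1 / 2 : ℝ) • z + (1 / 2 : ℝ) • w‖ ^ 2 / 2 =
      (s + ‖z‖ ^ 2 / 2) / 2 + (t + ‖w‖ ^ 2 / 2) / 2 - ‖z - w‖ ^ 2 / 8 := by
  rw [← smul_add, norm_smul, mul_pow, norm_add_sq_real, norm_sub_sq_real]
  norm_num
  ring

/-- The functional `(z, t) ↦ t + ‖z‖² / 2` attains its minimum on a nonempty closed convex set on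
which it is nonnegative. Applied to the epigraph of a convex lower semicontinuous `f`, this
minimises `f + ‖·‖² / 2` without resorting to extended real values. -/
lemma exists_forall_add_half_sq_norm_le [CompleteSpace V] {E : Set (V × ℝ)} (hne : E.Nonempty)
    (hcl : IsClosed E) (hconv : Convex ℝ E) (hnonneg : ∀ p ∈ E, 0 ≤ p.2 + ‖p.1‖ ^ 2 / 2) :
    ∃ p ∈ E, ∀ q ∈ E, p.2 + ‖p.1‖ ^ 2 / 2 ≤ q.2 + ‖q.1‖ ^ 2 / 2 := by
  set φ : V × ℝ → ℝ := fun p => p.2 + ‖p.1‖ ^ 2 / 2 with hφ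
  have hbdd : BddBelow (φ '' E) := ⟨0, by rintro _ ⟨p, hp, rfl⟩; exact hnonneg p hp⟩
  set m := sInf (φ '' E) with hm
  have hmle : ∀ p ∈ E, m ≤ φ p := fun p hp => csInf_le hbdd ⟨p, hp, rfl⟩
  have hex : ∀ n : ℕ, ∃ p ∈ E, φ p < m + 1 / ((n : ℝ) + 1) := fun n => by
    obtain ⟨_, ⟨p, hp, rfl⟩, h⟩ := exists_lt_of_csInf_lt (hne.image φ)
      (lt_add_of_pos_right m (Nat.one_div_pos_of_nat (α := ℝ) (n := n)))
    exact ⟨p, hp, h⟩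
  choose p hpE hp using hex
  have hφlim : Tendsto (fun n => φ (p n)) atTop (𝓝 m) := by
    refine tendsto_of_tendsto_of_tendsto_of_le_of_le tendsto_const_nhds ?_
      (fun n => hmle _ (hpE n)) (fun n => (hp n).le)
    simpa using tendsto_const_nhds.add (tendsto_one_div_add_atTop_nhds_zero_nat (𝕜 := ℝ))
  have hdist : ∀ i j, ‖(p i).1 - (p j).1‖ ^ 2 ≤ 4 * ((φ (p i) - m) + (φ (p j) - m)) := by
    intro i j
    have hmid := hmle _ (hconv (hpE i) (hpE j) (by norm_num : (0 : ℝ) ≤ 1 / 2)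
      (by norm_num : (0 : ℝ) ≤ 1 / 2) (by norm_num))
    have hid := midpoint_add_half_sq_norm (p i).1 (p j).1 (p i).2 (p j).2
    simp only [hφ, Prod.fst_add, Prod.snd_add, Prod.smul_fst, Prod.smul_snd, smul_eq_mul]
      at hmid ⊢
    linarith
  have hcauchy : CauchySeq fun n => (p n).1 := by
    refine Metric.cauchySeq_iff.2 fun ε hε => ?_
    have hev : ∀ᶠ n in atTop, φ (p n) < m + ε ^ 2 / 8 :=
      hφlim.eventually_lt_const (lt_add_of_pos_right m (by positivity))
    obtain ⟨N, hN⟩ := eventually_atTop.1 hev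
    refine ⟨N, fun i hi j hj => ?_⟩
    rw [dist_eq_norm]
    refine lt_of_pow_lt_pow_left₀ 2 hε.le ?_
    linarith [hdist i j, hN i hi, hN j hj]
  obtain ⟨z, hz⟩ := cauchySeq_tendsto_of_complete hcauchy
  have hsnd : Tendsto (fun n => (p n).2) atTop (𝓝 (m - ‖z‖ ^ 2 / 2)) := by
    have := hφlim.sub ((hz.norm.pow 2).div_const 2)
    simpa [hφ] using this
  refine ⟨(z, m - ‖z‖ ^ 2 / 2), hcl.mem_of_tendsto (hz.prodMk_nhds hsnd)
    (Eventually.of_forall hpE), fun q hq => ?_⟩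
  simpa [hφ] using hmle q hq

/-- The first-order optimality condition: at a minimiser `p` of `(z, t) ↦ t + ‖z‖² / 2` on a convex
set, the linearised functional `(z, t) ↦ t + ⟪p.1, z⟫` is minimal as well. -/
lemma add_sq_norm_le_add_inner_of_isMin {E : Set (V × ℝ)} (hconv : Convex ℝ E) {p q : V × ℝ}
    (hp : p ∈ E) (hq : q ∈ E) (hmin : ∀ q ∈ E, p.2 + ‖p.1‖ ^ 2 / 2 ≤ q.2 + ‖q.1‖ ^ 2 / 2) :
    p.2 + ‖p.1‖ ^ 2 ≤ q.2 + inner ℝ p.1 q.1 := by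
  set c := q.2 - p.2 + inner ℝ p.1 (q.1 - p.1) with hc
  have hseg : ∀ s : ℝ, 0 < s → s ≤ 1 → 0 ≤ c + s * (‖q.1 - p.1‖ ^ 2 / 2) := by
    intro s hs hs1
    have h := hmin _ (hconv.add_smul_sub_mem hp hq ⟨hs.le, hs1⟩)
    simp only [Prod.fst_add, Prod.snd_add, Prod.smul_fst, Prod.smul_snd, Prod.fst_sub,
      Prod.snd_sub, smul_eq_mul] at h
    rw [norm_add_sq_real, norm_smul, inner_smul_right, mul_pow, Real.norm_eq_abs, sq_abs] at h
    refine le_of_mul_le_mul_left ?_ hs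
    rw [hc]
    linarith
  have hlim : Tendsto (fun s : ℝ => c + s * (‖q.1 - p.1‖ ^ 2 / 2)) (𝓝[>] 0) (𝓝 c) := by
    have : Continuous fun s : ℝ => c + s * (‖q.1 - p.1‖ ^ 2 / 2) := by fun_prop
    simpa using (this.tendsto 0).mono_left nhdsWithin_le_nhds
  have h0 : 0 ≤ c := by
    refine ge_of_tendsto hlim ?_
    filter_upwards [Ioc_mem_nhdsGT (zero_lt_one' ℝ)] with s hs using hseg s hs.1 hs.2
  rw [hc, inner_sub_right, real_inner_self_eq_norm_sq] at h0
  linarith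

end Minimisation

/-! ### Minty's theorem -/

section Minty

variable {H : Type*} [NormedAddCommGroup H] [InnerProductSpace ℝ H]

/-- The epigraph of the Fitzpatrick function of `S ⊆ H × H`. The product `H × H` is given its Hilbert
norm through `WithLp 2`. -/
def fitzpatrickEpigraph (S : Set (H × H)) : Set (WithLp 2 (H × H) × ℝ) :=
  {p | ∀ q ∈ S, inner ℝ p.1.fst q.2 + inner ℝ q.1 p.1.snd - inner ℝ q.1 q.2 ≤ p.2}

lemma isClosed_fitzpatrickEpigraph (S : Set (H × H)) : IsClosed (fitzpatrickEpigraph S) := by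
  simp only [fitzpatrickEpigraph, Set.ofPred_forall]
  refine isClosed_biInter fun q _ => isClosed_le ?_ continuous_snd
  have h1 : Continuous fun p : WithLp 2 (H × H) × ℝ => p.1.fst :=
    (WithLp.prod_continuous_ofLp 2 H H).fst.comp continuous_fst
  have h2 : Continuous fun p : WithLp 2 (H × H) × ℝ => p.1.snd :=
    (WithLp.prod_continuous_ofLp 2 H H).snd.comp continuous_fst
  exact ((h1.inner continuous_const).add (continuous_const.inner h2)).sub continuous_const

lemma convex_fitzpatrickEpigraph (S : Set (H × H)) : Convex ℝ (fitzpatrickEpigraph S) := by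
  intro p hp p' hp' a b ha hb hab q hq
  have h := add_le_add (mul_le_mul_of_nonneg_left (hp q hq) ha)
    (mul_le_mul_of_nonneg_left (hp' q hq) hb)
  simp only [Prod.fst_add, Prod.snd_add, Prod.smul_fst, Prod.smul_snd, WithLp.add_fst,
    WithLp.add_snd, WithLp.smul_fst, WithLp.smul_snd, inner_add_left, inner_add_right,
    real_inner_smul_left, real_inner_smul_right, smul_eq_mul]
  have hone : inner ℝ q.1 q.2 = a * inner ℝ q.1 q.2 + b * inner ℝ q.1 q.2 := by
    rw [← add_mul, hab, one_mul]
  linarith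

/-- Minty's theorem for a set that consists of exactly the points monotonically related to all of
its points: the range of `Id + S` contains `0`. -/
lemma exists_neg_mem_of_mem_iff_forall_inner [CompleteSpace H] {S : Set (H × H)}
    (hS : ∀ p, p ∈ S ↔ ∀ q ∈ S, 0 ≤ inner ℝ (p.1 - q.1) (p.2 - q.2)) :
    ∃ x, (x, -x) ∈ S := by
  have hge : ∀ p ∈ fitzpatrickEpigraph S, inner ℝ p.1.fst p.1.snd ≤ p.2 := by
    intro p hp
    by_contra! hlt
    have hmem : (p.1.fst, p.1.snd) ∈ S := (hS _).2 fun q hq => by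
      have := hp q hq
      simp only [inner_sub_left, inner_sub_right]
      linarith
    have := hp _ hmem
    simp only at this
    linarith
  have hSE : ∀ q ∈ S, ((WithLp.toLp 2 q, inner ℝ q.1 q.2) : WithLp 2 (H × H) × ℝ) ∈
      fitzpatrickEpigraph S := by
    intro q hq r hr
    have := (hS q).1 hq r hr
    simp only [inner_sub_left, inner_sub_right] at this
    simp only [WithLp.toLp_fst, WithLp.toLp_snd]
    linarith
  have hne : S.Nonempty := by
    by_contra! h
    have : ((0, 0) : H × H) ∈ S := (hS _).2 (by simp [h])
    simp [h] at this
  obtain ⟨q₀, hq₀⟩ := hne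
  have hconv := convex_fitzpatrickEpigraph S
  obtain ⟨p, hp, hmin⟩ := exists_forall_add_half_sq_norm_le ⟨_, hSE q₀ hq₀⟩
    (isClosed_fitzpatrickEpigraph S) hconv fun p hp => by
      have h1 := hge p hp
      have h2 : 0 ≤ ‖p.1.fst + p.1.snd‖ ^ 2 := by positivity
      rw [norm_add_sq_real] at h2
      rw [WithLp.prod_norm_sq_eq_of_L2]
      linarith
  set x := p.1.fst
  set u := p.1.snd
  -- The optimality condition, with `⟪x, u⟫ ≤ p.2` used to complete the square.
  have hrel : ∀ q ∈ S, ‖x + u‖ ^ 2 ≤ inner ℝ (-u - q.1) (-x - q.2) := by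
    intro q hq
    have h1 := hge p hp
    have h2 := add_sq_norm_le_add_inner_of_isMin hconv hp (hSE q hq) hmin
    rw [WithLp.prod_norm_sq_eq_of_L2, WithLp.prod_inner_apply] at h2
    change p.2 + (‖x‖ ^ 2 + ‖u‖ ^ 2) ≤ inner ℝ q.1 q.2 + (inner ℝ x q.1 + inner ℝ u q.2) at h2
    rw [norm_add_sq_real]
    simp only [inner_sub_left, inner_sub_right, inner_neg_left, inner_neg_right]
    rw [real_inner_comm x u, real_inner_comm x q.1]
    linarith
  have hmem : (-u, -x) ∈ S := (hS _).2 fun q hq => (sq_nonneg _).trans (hrel q hq)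
  have h0 := hrel _ hmem
  simp only [sub_self, inner_zero_left] at h0
  have hux : x + u = 0 := by
    rw [← norm_eq_zero]
    exact pow_eq_zero_iff two_ne_zero |>.1 (le_antisymm h0 (sq_nonneg _))
  refine ⟨x, ?_⟩
  rwa [neg_eq_of_add_eq_zero_left hux] at hmem

lemma IsMaximallyMonotone.mem_gra_iff {A : H → Set H} (hA : IsMaximallyMonotone A) (p : H × H) :
    p ∈ gra A ↔ ∀ q ∈ gra A, 0 ≤ inner ℝ (p.1 - q.1) (p.2 - q.2) := by
  refine ⟨fun hp q hq => hA.1 p hp q hq, fun h => by_contra fun hp => hA.2 ?_⟩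
  have hgra : gra (fun x => {u | (x, u) ∈ insert p (gra A)}) = insert p (gra A) := rfl
  refine ⟨fun x => {u | (x, u) ∈ insert p (gra A)}, ?_, ?_⟩
  · rw [IsMonotone, hgra]
    rintro q (rfl | hq) r (rfl | hr)
    · simp
    · exact h r hr
    · rw [← neg_sub r.1, ← neg_sub r.2, inner_neg_neg]
      exact h q hq
    · exact hA.1 q hq r hr
  · rw [hgra]
    exact Set.ssubset_insert hp

/-- Minty's theorem: `Id + γ A` is surjective for `A` maximally monotone and `γ > 0`. -/
theorem IsMaximallyMonotone.exists_add_smul_eq [CompleteSpace H] {A : H → Set H}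
    (hA : IsMaximallyMonotone A) {γ : ℝ} (hγ : 0 < γ) (w : H) :
    ∃ y v, v ∈ A y ∧ y + γ • v = w := by
  -- Translating and scaling `A` to `γ A - w` reduces the claim to the point `0`.
  let S : Set (H × H) := {p | (p.1, γ⁻¹ • (p.2 + w)) ∈ gra A}
  have hS : ∀ p, p ∈ S ↔ ∀ q ∈ S, 0 ≤ inner ℝ (p.1 - q.1) (p.2 - q.2) := by
    intro p
    refine (hA.mem_gra_iff _).trans ⟨fun h q hq => ?_, fun h q hq => ?_⟩
    · have := h _ hq
      simp only [← smul_sub, add_sub_add_right_eq_sub, real_inner_smul_right] at this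
      exact (mul_nonneg_iff_of_pos_left (inv_pos.2 hγ)).1 this
    · have hqS : (q.1, γ • q.2 - w) ∈ S := by
        change (q.1, γ⁻¹ • (γ • q.2 - w + w)) ∈ gra A
        rwa [sub_add_cancel, inv_smul_smul₀ hγ.ne']
      have h1 := mul_nonneg (inv_pos.2 hγ).le (h _ hqS)
      rw [← real_inner_smul_right] at h1
      have hsub : γ⁻¹ • (p.2 + w) - q.2 = γ⁻¹ • (p.2 - (γ • q.2 - w)) := by
        simp only [smul_sub, smul_add, inv_smul_smul₀ hγ.ne']
        abel
      rwa [hsub]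
  obtain ⟨x, hx⟩ := exists_neg_mem_of_mem_iff_forall_inner hS
  refine ⟨x, γ⁻¹ • (-x + w), hx, ?_⟩
  rw [smul_inv_smul₀ hγ.ne']
  abel

lemma IsMonotone.inv {A : H → Set H} (hA : IsMonotone A) : IsMonotone (inv A) := by
  intro p hp q hq
  rw [real_inner_comm]
  exact hA p.swap hp q.swap hq

lemma IsMaximallyMonotone.inv {A : H → Set H} (hA : IsMaximallyMonotone A) :
    IsMaximallyMonotone (inv A) := by
  refine ⟨hA.1.inv, ?_⟩
  rintro ⟨B, hB, hsub, hnot⟩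
  exact hA.2 ⟨ResolventComp.inv B, hB.inv, fun p hp => hsub (a := p.swap) hp,
    fun h => hnot fun p hp => h (a := p.swap) hp⟩

end Minty

/-! ### Graph convergence -/

section GraphConvergence

lemma lowerLimit_subset_upperLimit {X : Type*} [TopologicalSpace X] (C : ℕ → Set X) :
    lowerLimit C ⊆ upperLimit C :=
  fun _ ⟨u, hu, hlim⟩ => ⟨u, id, strictMono_id, hu, hlim⟩

lemma PKConverges.of_subset {X : Type*} [TopologicalSpace X] {C : ℕ → Set X} {D : Set X}
    (hlower : D ⊆ lowerLimit C) (hupper : upperLimit C ⊆ D) : PKConverges C D :=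
  ⟨((lowerLimit_subset_upperLimit C).trans hupper).antisymm hlower,
    hupper.antisymm (hlower.trans (lowerLimit_subset_upperLimit C))⟩

lemma GraphConverges.inv {X : Type*} [TopologicalSpace X] {A : ℕ → X → Set X} {A' : X → Set X}
    (h : GraphConverges A A') : GraphConverges (fun n => inv (A n)) (inv A') := by
  refine PKConverges.of_subset ?_ ?_
  · intro p hp
    have hp' : p.swap ∈ lowerLimit fun n => gra (A n) := by rw [h.1]; exact hp
    obtain ⟨u, hu, hlim⟩ := hp'
    exact ⟨fun n => (u n).swap, hu, (continuous_swap.tendsto _).comp hlim⟩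
  · rintro p ⟨u, k, hk, hu, hlim⟩
    have hp' : p.swap ∈ upperLimit fun n => gra (A n) :=
      ⟨fun n => (u n).swap, k, hk, hu, (continuous_swap.tendsto _).comp hlim⟩
    rw [h.2] at hp'
    exact hp'

end GraphConvergence

/-! ### Convergence of resolvents -/

section Resolvents

variable {G : Type*} [NormedAddCommGroup G] [InnerProductSpace ℝ G]

/-- Resolvents of monotone operators are nonexpansive. -/
lemma norm_sub_le_of_inner_nonneg {y y' v v' : G} {γ : ℝ} (hγ : 0 < γ)
    (h : 0 ≤ inner ℝ (y - y') (v - v')) : ‖y - y'‖ ≤ ‖(y + γ • v) - (y' + γ • v')‖ := by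
  have hsplit : (y + γ • v) - (y' + γ • v') = (y - y') + γ • (v - v') := by
    rw [smul_sub]; abel
  rw [hsplit]
  refine le_of_sq_le_sq ?_ (norm_nonneg _)
  rw [norm_add_sq_real, real_inner_smul_right]
  have := mul_nonneg hγ.le h
  nlinarith [sq_nonneg ‖γ • (v - v')‖]

/-- Resolvents of a sequence of monotone operators, at points that converge to `y + γ v`, converge
to `y` as soon as `(y, v)` is the limit of some points of the graphs. -/
lemma tendsto_fst_of_tendsto_add_smul {A : ℕ → G → Set G} (hA : ∀ n, IsMonotone (A n))
    {γs : ℕ → ℝ} {γ : ℝ} (hγs : ∀ n, 0 < γs n) (hγ : Tendsto γs atTop (𝓝 γ))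
    {y v : G} {q : ℕ → G × G} (hqA : ∀ n, q n ∈ gra (A n)) (hq : Tendsto q atTop (𝓝 (y, v)))
    {ys vs : ℕ → G} (hvs : ∀ n, vs n ∈ A n (ys n))
    (hlim : Tendsto (fun n => ys n + γs n • vs n) atTop (𝓝 (y + γ • v))) :
    Tendsto ys atTop (𝓝 y) := by
  have hq1 : Tendsto (fun n => (q n).1) atTop (𝓝 y) := hq.fst_nhds
  have hq2 : Tendsto (fun n => (q n).2) atTop (𝓝 v) := hq.snd_nhds
  have hbound : Tendsto (fun n => (ys n + γs n • vs n) - ((q n).1 + γs n • (q n).2))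
      atTop (𝓝 0) := by
    simpa using hlim.sub (hq1.add (hγ.smul hq2))
  have hdiff : Tendsto (fun n => ys n - (q n).1) atTop (𝓝 0) :=
    squeeze_zero_norm (fun n => norm_sub_le_of_inner_nonneg (hγs n)
      (hA n (ys n, vs n) (hvs n) (q n) (hqA n))) (by simpa using hbound.norm)
  simpa using hdiff.add hq1

end Resolvents

/-! ### Resolvent compositions -/

section Compositions

variable {H G : Type*} [NormedAddCommGroup H] [InnerProductSpace ℝ H] [CompleteSpace H]
  [NormedAddCommGroup G] [InnerProductSpace ℝ G] [CompleteSpace G]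

lemma tendsto_clm_apply {E F : Type*} [NormedAddCommGroup E] [NormedSpace ℝ E]
    [NormedAddCommGroup F] [NormedSpace ℝ F] {T : ℕ → E →L[ℝ] F} {T' : E →L[ℝ] F} {z : ℕ → E}
    {z' : E} (hT : Tendsto T atTop (𝓝 T')) (hz : Tendsto z atTop (𝓝 z')) :
    Tendsto (fun n => T n (z n)) atTop (𝓝 (T' z')) :=
  (isBoundedBilinearMap_apply.continuous.tendsto (T', z')).comp (hT.prodMk_nhds hz)

/-- The resolvent of `L ◇_γ B` is `L* ∘ (Id + γ B)⁻¹ ∘ L`. -/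
lemma mem_gra_resolventComp_iff {L : H →L[ℝ] G} {γ : ℝ} (hγ : 0 < γ) {B : G → Set G} {p : H × H} :
    p ∈ gra (resolventComp L γ B) ↔ ∃ y v, v ∈ B y ∧ y + γ • v = L (p.1 + γ • p.2) ∧
      p.1 = ContinuousLinearMap.adjoint L y := by
  obtain ⟨x, u⟩ := p
  have hscale : ∀ y v, v + γ⁻¹ • y = L (u + γ⁻¹ • x) ↔ y + γ • v = L (x + γ • u) := by
    intro y v
    rw [← (smul_right_injective G hγ.ne').eq_iff]
    simp only [← map_smul, smul_add, smul_inv_smul₀ hγ.ne', add_comm]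
  have hmem : (x, u) ∈ gra (resolventComp L γ B) ↔
      ∃ y, (∃ v, v ∈ B y ∧ v + γ⁻¹ • y = L (u + γ⁻¹ • x)) ∧
        ContinuousLinearMap.adjoint L y = x := by
    simp only [gra, resolventComp, parallelComp, inv, Set.mem_ofPred_eq, Set.sub_singleton,
      Set.add_singleton, Set.mem_image, ContinuousLinearMap.adjoint_adjoint]
    constructor
    · rintro ⟨w, ⟨y, hy, hx⟩, rfl⟩
      exact ⟨y, by simpa using hy, hx⟩
    · rintro ⟨y, hy, hx⟩
      exact ⟨u + γ⁻¹ • x, ⟨y, hy, hx⟩, by simp⟩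
  rw [hmem]
  constructor
  · rintro ⟨y, ⟨v, hv, h⟩, hx⟩
    exact ⟨y, v, hv, (hscale y v).1 h, hx.symm⟩
  · rintro ⟨y, v, hv, h, hx⟩
    exact ⟨y, ⟨v, hv, (hscale y v).2 h⟩, hx.symm⟩

theorem GraphConverges.resolventComp {Ls : ℕ → H →L[ℝ] G} {L : H →L[ℝ] G}
    {Bs : ℕ → G → Set G} {B : G → Set G} {γs : ℕ → ℝ} {γ : ℝ}
    (hB_lim : GraphConverges Bs B) (hBs : ∀ n, IsMaximallyMonotone (Bs n))
    (hB : IsMaximallyMonotone B) (hγs : ∀ n, 0 < γs n) (hγ : 0 < γ)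
    (hL_lim : Tendsto Ls atTop (𝓝 L)) (hγ_lim : Tendsto γs atTop (𝓝 γ)) :
    GraphConverges (fun n => resolventComp (Ls n) (γs n) (Bs n)) (resolventComp L γ B) := by
  have hadj : Tendsto (fun n => ContinuousLinearMap.adjoint (Ls n)) atTop
      (𝓝 (ContinuousLinearMap.adjoint L)) :=
    (ContinuousLinearMap.adjoint (𝕜 := ℝ) (E := H) (F := G)).continuous.tendsto L |>.comp hL_lim
  have happrox : ∀ y v, v ∈ B y → ∃ q : ℕ → G × G, (∀ n, q n ∈ gra (Bs n)) ∧
      Tendsto q atTop (𝓝 (y, v)) := by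
    intro y v hv
    have : (y, v) ∈ lowerLimit fun n => gra (Bs n) := by rw [hB_lim.1]; exact hv
    exact this
  refine PKConverges.of_subset ?_ ?_
  · rintro ⟨x, u⟩ hxu
    obtain ⟨y, v, hv, hyv, hx⟩ := (mem_gra_resolventComp_iff hγ).1 hxu
    obtain ⟨q, hqB, hq⟩ := happrox y v hv
    -- The approximating points are those with resolvent argument `x + γ u`.
    choose ys vs hvs hys using fun n =>
      (hBs n).exists_add_smul_eq (hγs n) (Ls n (x + γ • u))
    have hlim : Tendsto ys atTop (𝓝 y) := by
      refine tendsto_fst_of_tendsto_add_smul (fun n => (hBs n).1) hγs hγ_lim hqB hq hvs ?_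
      simp only [hys, hyv]
      exact tendsto_clm_apply hL_lim tendsto_const_nhds
    have hxlim : Tendsto (fun n => ContinuousLinearMap.adjoint (Ls n) (ys n)) atTop (𝓝 x) := by
      have hx' : x = ContinuousLinearMap.adjoint L y := hx
      rw [hx']
      exact tendsto_clm_apply hadj hlim
    refine ⟨fun n => (ContinuousLinearMap.adjoint (Ls n) (ys n),
      (γs n)⁻¹ • (x + γ • u - ContinuousLinearMap.adjoint (Ls n) (ys n))), fun n => ?_,
      hxlim.prodMk_nhds ?_⟩
    · refine (mem_gra_resolventComp_iff (hγs n)).2 ⟨ys n, vs n, hvs n, ?_, rfl⟩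
      rw [hys, smul_inv_smul₀ (hγs n).ne', add_sub_cancel]
    · have := (hγ_lim.inv₀ hγ.ne').smul (hxlim.const_sub (x + γ • u))
      rwa [add_sub_cancel_left, inv_smul_smul₀ hγ.ne'] at this
  · rintro ⟨x, u⟩ ⟨p, k, hk, hp, hlim⟩
    have hk' := hk.tendsto_atTop
    choose ys vs hvs hys hxs using fun n => (mem_gra_resolventComp_iff (hγs (k n))).1 (hp n)
    obtain ⟨y, v, hv, hyv⟩ := hB.exists_add_smul_eq hγ (L (x + γ • u))
    obtain ⟨q, hqB, hq⟩ := happrox y v hv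
    have hxlim : Tendsto (fun n => (p n).1) atTop (𝓝 x) := hlim.fst_nhds
    have hulim : Tendsto (fun n => (p n).2) atTop (𝓝 u) := hlim.snd_nhds
    have hylim : Tendsto ys atTop (𝓝 y) := by
      refine tendsto_fst_of_tendsto_add_smul (fun n => (hBs (k n)).1) (fun n => hγs (k n))
        (hγ_lim.comp hk') (fun n => hqB (k n)) (hq.comp hk') hvs ?_
      simp only [hys, hyv]
      exact tendsto_clm_apply (hL_lim.comp hk') (hxlim.add ((hγ_lim.comp hk').smul hulim))
    refine (mem_gra_resolventComp_iff hγ).2 ⟨y, v, hv, hyv, tendsto_nhds_unique hxlim ?_⟩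
    simp only [hxs]
    exact tendsto_clm_apply (hadj.comp hk') hylim

end Compositions

end ResolventComp

theorem mainTheorem6 {H G : Type*}
    [NormedAddCommGroup H] [InnerProductSpace ℝ H] [CompleteSpace H]
    [NormedAddCommGroup G] [InnerProductSpace ℝ G] [CompleteSpace G]
    (Ls : ℕ → H →L[ℝ] G) (L : H →L[ℝ] G)
    (Bs : ℕ → G → Set G) (B : G → Set G)
    (γs : ℕ → ℝ) (γ : ℝ)
    (hBs : ∀ n, ResolventComp.IsMaximallyMonotone (Bs n))
    (hB : ResolventComp.IsMaximallyMonotone B)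
    (hγs : ∀ n, 0 < γs n) (hγ : 0 < γ)
    (hL_lim : Tendsto Ls atTop (𝓝 L))
    (hB_lim : ResolventComp.GraphConverges Bs B)
    (hγ_lim : Tendsto γs atTop (𝓝 γ))
    (hL_norm : ∀ n, ‖Ls n‖ ≤ 1) :
    ResolventComp.GraphConverges
        (fun n => ResolventComp.resolventComp (Ls n) (γs n) (Bs n))
        (ResolventComp.resolventComp L γ B) ∧
      ResolventComp.GraphConverges
        (fun n => ResolventComp.resolventCocomp (Ls n) (γs n) (Bs n))
        (ResolventComp.resolventCocomp L γ B) := by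
  refine ⟨hB_lim.resolventComp hBs hB hγs hγ hL_lim hγ_lim, ?_⟩
  have hγ_inv : Tendsto (fun n => 1 / γs n) atTop (𝓝 (1 / γ)) :=
    tendsto_const_nhds.div hγ_lim hγ.ne'
  exact (hB_lim.inv.resolventComp (fun n => (hBs n).inv) hB.inv
    (fun n => one_div_pos.2 (hγs n)) (one_div_pos.2 hγ) hL_lim hγ_inv).inv
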